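/- For $n\ge 0$ let $P_n(x)=\frac{1}{2^n n!}\frac{d^n}{dx^n}(x^2-1)^n$ be the $n$-th Legendre polynomial. The function $\theta\mapsto P_n(\cos\theta)$ has exactly $n$ zeros in $(0,\pi)$; list them increasingly as $\theta_1<\theta_2<\dots<\theta_n$ (they depend on $n$). Let $I=[a,b]$ with $0<a\le b<\pi$. Then there is a constant $C$, depending on $I$ but not on $n$, such that for every $n\ge 1$ for which the number of zeros $\theta_j$ lying in $I$ is even, $$\left|\;\Big|\sum_{\theta_j\in I}(-1)^j\theta_j\Big|-\frac{b-a}{2}\;\right|\le \frac{C}{n}.$$ In other words, for the same $n$, the regions of $I$ where $P_n(\cos\theta)$ is positive and where it is negative have asymptotically equal length: $$\Big|\,\operatorname{length}\{\theta\in I: P_n(\cos\theta)>0\}-\operatorname{length}\{\theta\in I:P_n(\cos\theta)<0\}\,\Big|\le\frac{C}{n}.$$ -/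

import Mathlib

open Polynomial in
/-- The Legendre polynomial `P_n`, by the Rodrigues formula
`P_n(x) = (1 / (2 ^ n * n!)) * (d/dx) ^ n (x ^ 2 - 1) ^ n`. -/
noncomputable def legendreP (n : ℕ) : Polynomial ℝ :=
  C (1 / (2 ^ n * (n.factorial : ℝ))) * derivative^[n] ((X ^ 2 - 1) ^ n)

/-- `θ 0 < θ 1 < ⋯ < θ (n - 1)` is the complete increasing list of the zeros of
`t ↦ P_n (cos t)` in `(0, π)`. The index is shifted by one: the zero with one-based
index `j + 1` is `θ j`. -/
def IsLegendreAngles (n : ℕ) (θ : Fin n → ℝ) : Prop :=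
  StrictMono θ ∧
    Set.range θ = {t : ℝ | t ∈ Set.Ioo 0 Real.pi ∧ (legendreP n).eval (Real.cos t) = 0}

/-! Write `N = n + 1/2` and `h = π / N`. The function `√(sin t) · P_n(cos t)` satisfies `u'' + (N² +
1/(4 sin² t)) u = 0`, so by Sturm comparison with a sine of frequency `N` every open subinterval of
`(0, π)` longer than `h` contains a zero (`exists_legendre_zero`). Hence the `n + 1` gaps cut out by
`0`, the zeros and `π` are each at most `h`. They sum to `π = (n + 1/2) h`, so their total deficit
from `h` is only `h/2`: the zeros are almost equally spaced, and no asymptotics of `P_n` are needed.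

An even number of zeros cuts `I` into an odd number of pieces, on which `P_n(cos t)` alternates in
sign. The alternating sum of their lengths is within the total deficit of the alternating sum of
equal lengths `h`, which is `h` itself (`abs_sum_neg_one_pow_mul_le`). It is therefore `O(1/n)`.
This signed length is the difference of the two measures up to sign, and summation by parts makes it
`(b - a) - 2 |∑ (-1)^j θ_j|`, so both bounds follow from one estimate, with a constant independent
of `I`. -/

/-! ### Legendre's equation and the leading coefficient. -/

open Polynomial in
lemma iterate_derivative_sq_sub_one_pow (n k : ℕ) :
    (X ^ 2 - 1) * derivative^[k + 2] ((X ^ 2 - 1 : ℝ[X]) ^ n) +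
      C (2 * ((k : ℝ) + 1 - n)) * X * derivative^[k + 1] ((X ^ 2 - 1 : ℝ[X]) ^ n) +
      C (((k : ℝ) + 1) * (k - 2 * n)) * derivative^[k] ((X ^ 2 - 1 : ℝ[X]) ^ n) = 0 := by
  induction k with
  | zero =>
    -- With `y = (x² - 1)^n`, one derivative of `(x² - 1) y' = 2 n x y` is the case `k = 0`; each
    -- further derivative raises `k` by one.
    have h : (X ^ 2 - 1) * derivative ((X ^ 2 - 1 : ℝ[X]) ^ n) =
        C (2 * (n : ℝ)) * X * (X ^ 2 - 1) ^ n := by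
      cases n with
      | zero => simp
      | succ m =>
        simp only [derivative_pow, derivative_sub, derivative_one]
        simp
        ring
    have h2 := congrArg derivative h
    simp only [derivative_mul, derivative_sub, derivative_X_pow, derivative_one, derivative_C,
      derivative_X] at h2
    simp only [Function.iterate_succ, Function.iterate_zero, Function.comp, id]
    simp at h2 ⊢
    linear_combination h2
  | succ k ih =>
    have h2 := congrArg derivative ih
    simp only [derivative_mul, derivative_add, derivative_sub, derivative_X_pow, derivative_one,
      derivative_C, derivative_X, derivative_zero, ← Function.iterate_succ_apply' derivative] at h2
    simp at h2 ⊢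
    rw [show (C 2 : ℝ[X]) = 2 from rfl] at h2 ⊢
    linear_combination h2

open Polynomial in
/-- Legendre's differential equation. -/
lemma legendreP_ode (n : ℕ) (x : ℝ) :
    (1 - x ^ 2) * (derivative (derivative (legendreP n))).eval x -
      2 * x * (derivative (legendreP n)).eval x + n * (n + 1) * (legendreP n).eval x = 0 := by
  have h := congrArg (eval x) (iterate_derivative_sq_sub_one_pow n n)
  simp only [Function.iterate_succ_apply'] at h
  simp [legendreP] at h ⊢
  linear_combination (-((n.factorial : ℝ)⁻¹ * (2 ^ n)⁻¹)) * h

open Polynomial in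
lemma natDegree_legendreP_le (n : ℕ) : (legendreP n).natDegree ≤ n := by
  have h1 : ((X ^ 2 - 1 : ℝ[X]) ^ n).natDegree ≤ n * 2 := by
    refine natDegree_pow_le.trans (Nat.mul_le_mul_left _ ?_)
    compute_degree
  have h2 := natDegree_iterate_derivative ((X ^ 2 - 1 : ℝ[X]) ^ n) n
  refine (natDegree_C_mul_le _ _).trans ?_
  omega

open Polynomial in
lemma coeff_legendreP_pos (n : ℕ) : 0 < (legendreP n).coeff n := by
  have hm : (X ^ 2 - 1 : ℝ[X]).Monic := monic_X_pow_sub_C (1 : ℝ) two_ne_zero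
  have hd : (X ^ 2 - 1 : ℝ[X]).natDegree = 2 := natDegree_X_pow_sub_C (r := (1 : ℝ))
  have h1 : ((X ^ 2 - 1 : ℝ[X]) ^ n).coeff (n + n) = 1 := by
    have := (hm.pow n).coeff_natDegree
    rwa [hm.natDegree_pow, hd, mul_two] at this
  have h2 : 0 < ((n + n).descFactorial n : ℝ) := by
    exact_mod_cast Nat.descFactorial_pos.mpr (by omega)
  rw [legendreP, coeff_C_mul, coeff_iterate_derivative, h1]
  simp only [nsmul_eq_mul, mul_one]
  positivity

lemma natDegree_legendreP (n : ℕ) : (legendreP n).natDegree = n :=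
  le_antisymm (natDegree_legendreP_le n)
    (Polynomial.le_natDegree_of_ne_zero (coeff_legendreP_pos n).ne')

lemma legendreP_ne_zero (n : ℕ) : legendreP n ≠ 0 := by
  intro h
  simpa [h] using coeff_legendreP_pos n

/-! ### Sturm comparison and existence of zeros. -/

/-- Sturm comparison with `sin (N (t - α))`. -/
lemma exists_zero_of_sturm {u u' Q : ℝ → ℝ} {α N : ℝ} (hN : 0 < N)
    (hu : ∀ t ∈ Set.Icc α (α + Real.pi / N), HasDerivAt u (u' t) t)
    (hu' : ∀ t ∈ Set.Icc α (α + Real.pi / N), HasDerivAt u' (-(Q t * u t)) t)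
    (hQ : ∀ t ∈ Set.Icc α (α + Real.pi / N), N ^ 2 ≤ Q t) :
    ∃ t ∈ Set.Icc α (α + Real.pi / N), u t = 0 := by
  by_contra! hne
  wlog hpos : 0 < u α generalizing u u'
  · have hl : α ∈ Set.Icc α (α + Real.pi / N) := ⟨le_rfl, by have := Real.pi_pos; simp; positivity⟩
    refine this (u := fun t => -u t) (u' := fun t => -u' t) (fun t ht => (hu t ht).neg)
      (fun t ht => ?_) (fun t ht => neg_ne_zero.mpr (hne t ht)) ?_
    · refine HasDerivAt.congr_deriv ((hu' t ht).neg) ?_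
      ring
    · have := lt_of_le_of_ne (not_lt.mp hpos) (hne α hl)
      linarith
  have hle : α ≤ α + Real.pi / N := by have := Real.pi_pos; simp; positivity
  have hcont : ContinuousOn u (Set.Icc α (α + Real.pi / N)) :=
    fun t ht => (hu t ht).continuousAt.continuousWithinAt
  have hall : ∀ t ∈ Set.Icc α (α + Real.pi / N), 0 < u t := by
    intro t ht
    by_contra hcon
    have hsub : Set.Icc α t ⊆ Set.Icc α (α + Real.pi / N) := Set.Icc_subset_Icc_right ht.2
    obtain ⟨s, hs, hs0⟩ := intermediate_value_Icc' ht.1 (hcont.mono hsub)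
      ⟨not_lt.mp hcon, hpos.le⟩
    exact hne s (hsub hs) hs0
  -- The Wronskian of `u` with `sin (N (t - α))` is nondecreasing while `u > 0`, yet it falls from
  -- `N u(α) > 0` to `-N u(α + π/N) < 0`.
  have hW : ∀ t ∈ Set.Icc α (α + Real.pi / N),
      HasDerivAt (fun t => u t * (N * Real.cos (N * (t - α))) - u' t * Real.sin (N * (t - α)))
        ((Q t - N ^ 2) * u t * Real.sin (N * (t - α))) t := by
    intro t ht
    have hlin : HasDerivAt (fun t => N * (t - α)) N t := by
      simpa using ((hasDerivAt_id t).sub_const α).const_mul N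
    refine HasDerivAt.congr_deriv (((hu t ht).mul (hlin.cos.const_mul N)).sub ((hu' t ht).mul hlin.sin)) ?_
    ring
  have hmono : MonotoneOn (fun t => u t * (N * Real.cos (N * (t - α))) -
      u' t * Real.sin (N * (t - α))) (Set.Icc α (α + Real.pi / N)) := by
    refine monotoneOn_of_hasDerivWithinAt_nonneg (convex_Icc _ _)
      (fun t ht => (hW t ht).continuousAt.continuousWithinAt)
      (fun t ht => (hW t (interior_subset ht)).hasDerivWithinAt) ?_
    intro t ht
    have ht := interior_subset ht
    refine mul_nonneg (mul_nonneg (sub_nonneg.mpr (hQ t ht)) (hall t ht).le)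
      (Real.sin_nonneg_of_nonneg_of_le_pi (mul_nonneg hN.le (by linarith [ht.1])) ?_)
    have h3 : t - α ≤ Real.pi / N := by linarith [ht.2]
    rwa [le_div_iff₀' hN] at h3
  have h := hmono (Set.left_mem_Icc.mpr hle) (Set.right_mem_Icc.mpr hle) hle
  have e : N * (Real.pi / N) = Real.pi := by field_simp
  simp [e] at h
  have h1 := mul_pos hpos hN
  have h2 := mul_pos (hall _ (Set.right_mem_Icc.mpr hle)) hN
  linarith

open Polynomial in
lemma hasDerivAt_eval_cos (p : ℝ[X]) (t : ℝ) :
    HasDerivAt (fun t => p.eval (Real.cos t)) (-Real.sin t * (derivative p).eval (Real.cos t)) t := by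
  refine HasDerivAt.congr_deriv ((p.hasDerivAt (Real.cos t)).comp t (Real.hasDerivAt_cos t)) ?_
  ring

open Polynomial in
lemma exists_legendre_zero {n : ℕ} {α β : ℝ} (hα : 0 ≤ α) (hβ : β ≤ Real.pi)
    (hαβ : Real.pi / (n + 1 / 2) < β - α) :
    ∃ t ∈ Set.Ioo α β, (legendreP n).eval (Real.cos t) = 0 := by
  set N : ℝ := n + 1 / 2 with hNdef
  have hN : 0 < N := by positivity
  -- Centring a closed interval of length `π / N` inside `(α, β)` keeps it away from `0` and `π`,
  -- where `√(sin t)` is not differentiable.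
  obtain ⟨δ, hδ⟩ : ∃ δ, δ = (β - α - Real.pi / N) / 2 := ⟨_, rfl⟩
  have hsub : ∀ t ∈ Set.Icc (α + δ) (α + δ + Real.pi / N), t ∈ Set.Ioo α β := by
    intro t ht
    constructor <;> linarith [ht.1, ht.2]
  have hsin : ∀ t ∈ Set.Icc (α + δ) (α + δ + Real.pi / N), 0 < Real.sin t := by
    intro t ht
    have := hsub t ht
    exact Real.sin_pos_of_pos_of_lt_pi (by linarith [this.1]) (by linarith [this.2])
  have hs : ∀ t ∈ Set.Icc (α + δ) (α + δ + Real.pi / N),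
      HasDerivAt (fun t => √(Real.sin t)) (Real.cos t / (2 * √(Real.sin t))) t :=
    fun t ht => (Real.hasDerivAt_sin t).sqrt (hsin t ht).ne'
  -- The factor `√(sin t)` removes the first-order term of Legendre's equation in the variable `t`,
  -- and leaves a potential above `N²`.
  obtain ⟨t, ht, h0⟩ := exists_zero_of_sturm (α := α + δ) (N := N)
    (u := fun t => √(Real.sin t) * (legendreP n).eval (Real.cos t))
    (u' := fun t => Real.cos t / (2 * √(Real.sin t)) * (legendreP n).eval (Real.cos t) -
      √(Real.sin t) ^ 3 * (derivative (legendreP n)).eval (Real.cos t))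
    (Q := fun t => N ^ 2 + 1 / (4 * Real.sin t ^ 2)) hN
    (fun t ht => by
      refine HasDerivAt.congr_deriv ((hs t ht).mul (hasDerivAt_eval_cos (legendreP n) t)) ?_
      have h2 : √(Real.sin t) ^ 2 = Real.sin t := Real.sq_sqrt (hsin t ht).le
      rw [← h2, Real.sqrt_sq (Real.sqrt_nonneg _)]
      ring)
    (fun t ht => by
      have hp := Real.sqrt_pos.mpr (hsin t ht)
      refine HasDerivAt.congr_deriv ((((Real.hasDerivAt_cos t).div ((hs t ht).const_mul 2) (by positivity)).mul
        (hasDerivAt_eval_cos (legendreP n) t)).sub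
        (((hs t ht).pow 3).mul (hasDerivAt_eval_cos (derivative (legendreP n)) t))) ?_
      have h2 : √(Real.sin t) ^ 2 = Real.sin t := Real.sq_sqrt (hsin t ht).le
      have h3 := Real.sin_sq_add_cos_sq t
      have ho := legendreP_ode n (Real.cos t)
      simp only [Pi.div_apply, Pi.pow_apply, Nat.cast_ofNat, show 3 - 1 = 2 from rfl]
      generalize √(Real.sin t) = s at *
      rw [← h2] at h3 ⊢
      generalize Real.cos t = c at *
      rw [show (1 : ℝ) - c ^ 2 = (s ^ 2) ^ 2 by linarith] at ho
      rw [hNdef]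
      have hc : c ^ 2 = 1 - s ^ 4 := by linear_combination h3
      field_simp
      linear_combination 16 * s ^ 4 * ho - 4 * (legendreP n).eval c * hc)
    (fun t ht => by
      have := hsin t ht
      have : 0 ≤ 1 / (4 * Real.sin t ^ 2) := by positivity
      linarith)
  exact ⟨t, hsub t ht, by simpa [(Real.sqrt_pos.mpr (hsin t ht)).ne'] using h0⟩

-- The `n` values `cos (θ j)` are distinct because `cos` is injective on `[0, π]`, and the degree
-- leaves room for no other root, nor for multiplicity.
open Polynomial in
lemma legendreP_eq_prod {n : ℕ} {θ : Fin n → ℝ} (hmono : StrictMono θ)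
    (hθ : ∀ j, θ j ∈ Set.Ioo 0 Real.pi) (h0 : ∀ j, (legendreP n).eval (Real.cos (θ j)) = 0) :
    legendreP n = C ((legendreP n).coeff n) * ∏ j, (X - C (Real.cos (θ j))) := by
  have hinj : Function.Injective fun j => Real.cos (θ j) := fun i j hij =>
    hmono.injective (Real.injOn_cos (Set.Ioo_subset_Icc_self (hθ i))
      (Set.Ioo_subset_Icc_self (hθ j)) hij)
  have hle : (Finset.univ.val.map fun j => Real.cos (θ j)) ≤ (legendreP n).roots := by
    rw [Multiset.le_iff_subset (Finset.univ.nodup.map hinj)]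
    intro x hx
    obtain ⟨j, -, rfl⟩ := Multiset.mem_map.mp hx
    exact (mem_roots (legendreP_ne_zero n)).mpr (h0 j)
  have hcard : (legendreP n).roots.card ≤ n :=
    (card_roots' _).trans (natDegree_legendreP_le n)
  have heq := Multiset.eq_of_le_of_card_le hle (by simpa using hcard)
  have hfac := C_leadingCoeff_mul_prod_multiset_X_sub_C (p := legendreP n)
    (by rw [← heq, natDegree_legendreP]; simp)
  rw [← heq, leadingCoeff, natDegree_legendreP, Multiset.map_map] at hfac
  exact hfac.symm

lemma isLegendreAngles_of_strictMono {n : ℕ} {θ : Fin n → ℝ} (hmono : StrictMono θ)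
    (hθ : ∀ j, θ j ∈ Set.Ioo 0 Real.pi) (h0 : ∀ j, (legendreP n).eval (Real.cos (θ j)) = 0) :
    IsLegendreAngles n θ := by
  refine ⟨hmono, Set.Subset.antisymm ?_ ?_⟩
  · rintro _ ⟨j, rfl⟩
    exact ⟨hθ j, h0 j⟩
  · rintro t ⟨ht, htz⟩
    rw [legendreP_eq_prod hmono hθ h0] at htz
    simp only [Polynomial.eval_mul, Polynomial.eval_C, Polynomial.eval_prod, Polynomial.eval_sub,
      Polynomial.eval_X, mul_eq_zero, (coeff_legendreP_pos n).ne', false_or,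
      Finset.prod_eq_zero_iff, Finset.mem_univ, true_and] at htz
    obtain ⟨j, hj⟩ := htz
    exact ⟨j, Real.injOn_cos (Set.Ioo_subset_Icc_self (hθ j)) (Set.Ioo_subset_Icc_self ht)
      (by linarith)⟩

/-- Each of the `n` intervals of length `π / n > π / (n + 1/2)` contains a zero, and `n` zeros are
all there are. A strictly increasing list is determined by its range. -/
lemma existsUnique_isLegendreAngles (n : ℕ) : ∃! θ : Fin n → ℝ, IsLegendreAngles n θ := by
  have hpi := Real.pi_pos
  have hex : ∀ j : Fin n, ∃ t ∈ Set.Ioo ((j : ℝ) * (Real.pi / n)) (((j : ℝ) + 1) * (Real.pi / n)),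
      (legendreP n).eval (Real.cos t) = 0 := by
    intro j
    have hn : (0 : ℝ) < n := by exact_mod_cast j.pos
    have hj : (j : ℝ) + 1 ≤ n := by exact_mod_cast j.isLt
    refine exists_legendre_zero (by positivity) ?_ ?_
    · calc ((j : ℝ) + 1) * (Real.pi / n) ≤ n * (Real.pi / n) := by gcongr
        _ = Real.pi := by field_simp
    · calc Real.pi / (n + 1 / 2) < Real.pi / n := by gcongr; linarith
        _ = _ := by ring
  choose θ hθ h0 using hex
  have hmono : StrictMono θ := by
    intro i j hij
    have hij' : (i : ℝ) + 1 ≤ j := by exact_mod_cast hij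
    have : ((i : ℝ) + 1) * (Real.pi / n) ≤ j * (Real.pi / n) := by gcongr
    linarith [(hθ i).2, (hθ j).1]
  have hθ' : IsLegendreAngles n θ := by
    refine isLegendreAngles_of_strictMono hmono (fun j => ?_) h0
    have hn : (0 : ℝ) < n := by exact_mod_cast j.pos
    have hj : (j : ℝ) + 1 ≤ n := by exact_mod_cast j.isLt
    refine ⟨lt_of_le_of_lt (by positivity) (hθ j).1, ?_⟩
    calc θ j < ((j : ℝ) + 1) * (Real.pi / n) := (hθ j).2
      _ ≤ n * (Real.pi / n) := by gcongr
      _ = Real.pi := by field_simp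
  exact ⟨θ, hθ', fun φ hφ => (hφ.1.range_inj hθ'.1).mp (hφ.2.trans hθ'.2.symm)⟩

/-! ### Gaps between consecutive zeros and the signs on them. -/

/-- The angles `θ 0 < ⋯ < θ (n - 1)` shifted by one and framed by `0` and `π`. -/
noncomputable def framedAngles {n : ℕ} (θ : Fin n → ℝ) (k : ℕ) : ℝ :=
  if k = 0 then 0 else if h : k - 1 < n then θ ⟨k - 1, h⟩ else Real.pi

section framedAngles

variable {n : ℕ} {θ : Fin n → ℝ}

lemma framedAngles_zero : framedAngles θ 0 = 0 := rfl

lemma framedAngles_succ (j : Fin n) : framedAngles θ (j + 1) = θ j := by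
  simp [framedAngles]

lemma framedAngles_of_lt {k : ℕ} (hk : n < k) : framedAngles θ k = Real.pi := by
  rw [framedAngles, if_neg (by omega), dif_neg (by omega)]

lemma IsLegendreAngles.mem_Ioo (hθ : IsLegendreAngles n θ) (j : Fin n) :
    θ j ∈ Set.Ioo 0 Real.pi :=
  (hθ.2.subset (Set.mem_range_self j)).1

lemma IsLegendreAngles.eval_eq_zero (hθ : IsLegendreAngles n θ) (j : Fin n) :
    (legendreP n).eval (Real.cos (θ j)) = 0 :=
  (hθ.2.subset (Set.mem_range_self j)).2

lemma IsLegendreAngles.framedAngles_monotone (hθ : IsLegendreAngles n θ) :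
    Monotone (framedAngles θ) := by
  refine monotone_nat_of_le_succ fun k => ?_
  rcases lt_or_ge k n with hk | hk
  · rw [framedAngles_succ ⟨k, hk⟩]
    rcases k with _ | k
    · exact (hθ.mem_Ioo _).1.le
    · rw [framedAngles_succ ⟨k, by omega⟩]
      exact hθ.1.monotone (Fin.mk_le_mk.mpr (Nat.le_succ k))
  · rw [framedAngles_of_lt (k := k + 1) (by omega)]
    rcases k with _ | k
    · exact Real.pi_pos.le
    · rcases lt_or_ge k n with h | h
      · rw [framedAngles_succ ⟨k, h⟩]
        exact (hθ.mem_Ioo _).2.le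
      · rw [framedAngles_of_lt (by omega)]

/-- A longer gap would contain a zero strictly between two consecutive entries of the list. -/
lemma IsLegendreAngles.framedAngles_succ_sub_le (hθ : IsLegendreAngles n θ) (k : ℕ) :
    framedAngles θ (k + 1) - framedAngles θ k ≤ Real.pi / (n + 1 / 2) := by
  by_contra! hlt
  have hle : framedAngles θ (k + 1) ≤ Real.pi := by
    refine (hθ.framedAngles_monotone (le_max_left (k + 1) (n + 1))).trans_eq ?_
    exact framedAngles_of_lt (by omega)
  have hge : 0 ≤ framedAngles θ k := hθ.framedAngles_monotone (Nat.zero_le k)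
  obtain ⟨t, ht, ht0⟩ := exists_legendre_zero hge hle hlt
  obtain ⟨j, rfl⟩ := hθ.2.superset ⟨⟨hge.trans_lt ht.1, ht.2.trans_le hle⟩, ht0⟩
  rw [← framedAngles_succ (θ := θ) j] at ht
  have h1 := hθ.framedAngles_monotone.reflect_lt ht.1
  have h2 := hθ.framedAngles_monotone.reflect_lt ht.2
  omega

lemma IsLegendreAngles.framedAngles_add_sub_le (hθ : IsLegendreAngles n θ) (i k : ℕ) :
    framedAngles θ (i + k) - framedAngles θ i ≤ k * (Real.pi / (n + 1 / 2)) := by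
  induction k with
  | zero => simp
  | succ k ih =>
    have := hθ.framedAngles_succ_sub_le (i + k)
    rw [← add_assoc]
    push_cast
    linarith

/-- After exactly `k` zeros the sign is `(-1) ^ k`. -/
lemma IsLegendreAngles.sign_eval (hθ : IsLegendreAngles n θ) {k : ℕ} (hk : k ≤ n) {t : ℝ}
    (ht : t ∈ Set.Ioo (framedAngles θ k) (framedAngles θ (k + 1))) :
    0 < (-1) ^ k * (legendreP n).eval (Real.cos t) := by
  have hle : framedAngles θ (k + 1) ≤ Real.pi := by
    refine (hθ.framedAngles_monotone (le_max_left (k + 1) (n + 1))).trans_eq ?_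
    exact framedAngles_of_lt (by omega)
  have hge : 0 ≤ framedAngles θ k := hθ.framedAngles_monotone (Nat.zero_le k)
  -- As `cos` decreases on `[0, π]`, exactly the first `k` factors are negative at `t`.
  have hprod : ∏ j, (Real.cos t - Real.cos (θ j)) =
      (∏ j ∈ Finset.range k, (Real.cos t - Real.cos (framedAngles θ (j + 1)))) *
        ∏ j ∈ Finset.Ico k n, (Real.cos t - Real.cos (framedAngles θ (j + 1))) := by
    rw [Finset.prod_range_mul_prod_Ico _ hk,
      ← Fin.prod_univ_eq_prod_range (fun j => Real.cos t - Real.cos (framedAngles θ (j + 1)))]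
    simp only [framedAngles_succ]
  have h1 : (-1) ^ k * ∏ j ∈ Finset.range k, (Real.cos t - Real.cos (framedAngles θ (j + 1))) =
      ∏ j ∈ Finset.range k, (Real.cos (framedAngles θ (j + 1)) - Real.cos t) := by
    nth_rw 1 [← Finset.card_range k]
    rw [← Finset.prod_const, ← Finset.prod_mul_distrib]
    exact Finset.prod_congr rfl fun _ _ => by ring
  have h2 : 0 < ∏ j ∈ Finset.range k, (Real.cos (framedAngles θ (j + 1)) - Real.cos t) := by
    refine Finset.prod_pos fun j hj => sub_pos.mpr ?_
    have hj' : j + 1 ≤ k := Finset.mem_range.mp hj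
    exact Real.cos_lt_cos_of_nonneg_of_le_pi (hθ.framedAngles_monotone (Nat.zero_le _))
      (ht.2.le.trans hle) ((hθ.framedAngles_monotone hj').trans_lt ht.1)
  have h3 : 0 < ∏ j ∈ Finset.Ico k n, (Real.cos t - Real.cos (framedAngles θ (j + 1))) := by
    refine Finset.prod_pos fun j hj => sub_pos.mpr ?_
    obtain ⟨hj1, hj2⟩ := Finset.mem_Ico.mp hj
    refine Real.cos_lt_cos_of_nonneg_of_le_pi (hge.trans ht.1.le) ?_
      (ht.2.trans_le (hθ.framedAngles_monotone (by omega)))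
    rw [framedAngles_succ ⟨j, hj2⟩]
    exact (hθ.mem_Ioo _).2.le
  rw [legendreP_eq_prod hθ.1 hθ.mem_Ioo hθ.eval_eq_zero]
  simp only [Polynomial.eval_mul, Polynomial.eval_C, Polynomial.eval_prod, Polynomial.eval_sub,
    Polynomial.eval_X]
  rw [hprod, mul_left_comm, ← mul_assoc ((-1) ^ k), h1]
  have := coeff_legendreP_pos n
  positivity

end framedAngles

/-! ### Alternating sums and signed length. -/

lemma sum_neg_one_pow_mul_sub (x : ℕ → ℝ) (m : ℕ) :
    ∑ k ∈ Finset.range (m + 1), (-1) ^ k * (x (k + 1) - x k) =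
      (-1) ^ m * x (m + 1) - x 0 + 2 * ∑ k ∈ Finset.range m, (-1) ^ k * x (k + 1) := by
  induction m with
  | zero => simp
  | succ m ih =>
    rw [Finset.sum_range_succ, ih, Finset.sum_range_succ (n := m)]
    ring

lemma sum_neg_one_pow_mul_nonpos_of_even {x : ℕ → ℝ} (hx : Monotone x) {m : ℕ} (hm : Even m) :
    ∑ k ∈ Finset.range m, (-1) ^ k * x k ≤ 0 := by
  obtain ⟨r, rfl⟩ := hm
  induction r with
  | zero => simp
  | succ r ih =>
    rw [show r + 1 + (r + 1) = r + r + 1 + 1 by ring, Finset.sum_range_succ, Finset.sum_range_succ,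
      pow_succ, (Even.add_self r).neg_one_pow]
    linarith [hx (Nat.le_succ (r + r))]

/-- With an odd number of terms the alternating sum of the constant `h` is `h`; replacing `h` by `d
k` costs at most the sum of the deficits `h - d k`. -/
lemma abs_sum_neg_one_pow_mul_le {d : ℕ → ℝ} {h : ℝ} {m : ℕ} (hm : Even m) (h0 : 0 ≤ h)
    (hd : ∀ k, d k ≤ h) :
    |∑ k ∈ Finset.range (m + 1), (-1) ^ k * d k| ≤
      h + ((m + 1) * h - ∑ k ∈ Finset.range (m + 1), d k) := by
  have e : ∑ k ∈ Finset.range (m + 1), (-1) ^ k * d k =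
      h - ∑ k ∈ Finset.range (m + 1), (-1) ^ k * (h - d k) := by
    have : ∑ k ∈ Finset.range (m + 1), (-1 : ℝ) ^ k * h = h := by
      rw [← Finset.sum_mul, neg_one_geom_sum, if_neg (by simpa [Nat.even_add_one] using hm), one_mul]
    simp only [mul_sub, Finset.sum_sub_distrib, this]
    ring
  rw [e]
  refine (abs_sub _ _).trans ?_
  rw [abs_of_nonneg h0]
  gcongr
  refine (Finset.abs_sum_le_sum_abs _ _).trans_eq ?_
  have : ∀ k ∈ Finset.range (m + 1), |(-1) ^ k * (h - d k)| = h - d k := fun k _ => by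
    rw [abs_mul, abs_neg_one_pow, one_mul, abs_of_nonneg (sub_nonneg.mpr (hd k))]
  rw [Finset.sum_congr rfl this]
  simp

lemma volume_real_pos_sub_volume_real_neg {f : ℝ → ℝ} (hf : Measurable f) {x : ℕ → ℝ}
    (hx : Monotone x) {s : ℝ} (hs : s = 1 ∨ s = -1) {m : ℕ}
    (hsign : ∀ k < m, ∀ t ∈ Set.Ioo (x k) (x (k + 1)), 0 < s * (-1) ^ k * f t) :
    MeasureTheory.volume.real {t | t ∈ Set.Icc (x 0) (x m) ∧ 0 < f t} -
      MeasureTheory.volume.real {t | t ∈ Set.Icc (x 0) (x m) ∧ f t < 0} =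
    s * ∑ k ∈ Finset.range m, (-1) ^ k * (x (k + 1) - x k) := by
  have hP : MeasurableSet {t | 0 < f t} := measurableSet_lt measurable_const hf
  have hN : MeasurableSet {t | f t < 0} := measurableSet_lt hf measurable_const
  -- This is the sign of `f`, constantly `s * (-1) ^ k` on the `k`-th open piece; the division
  -- points have measure zero.
  let g : ℝ → ℝ := {t | 0 < f t}.indicator 1 - {t | f t < 0}.indicator 1
  have hI : ∀ {A : Set ℝ}, MeasurableSet A → ∀ a b : ℝ,
      MeasureTheory.IntegrableOn (A.indicator (1 : ℝ → ℝ)) (Set.Icc a b) := fun hA a b =>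
    (MeasureTheory.integrableOn_const (C := (1 : ℝ)) (by simp)).indicator hA
  have hint : ∀ a b : ℝ, MeasureTheory.IntegrableOn g (Set.Icc a b) := fun a b =>
    (hI hP a b).sub (hI hN a b)
  have hset : ∀ {A : Set ℝ}, MeasurableSet A →
      ∫ t in Set.Icc (x 0) (x m), A.indicator (1 : ℝ → ℝ) t =
        MeasureTheory.volume.real (Set.Icc (x 0) (x m) ∩ A) := fun hA => by
    rw [MeasureTheory.integral_indicator_one hA, MeasureTheory.measureReal_restrict_apply hA,
      Set.inter_comm]
  have h1 : ∫ t in Set.Icc (x 0) (x m), g t =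
      MeasureTheory.volume.real {t | t ∈ Set.Icc (x 0) (x m) ∧ 0 < f t} -
      MeasureTheory.volume.real {t | t ∈ Set.Icc (x 0) (x m) ∧ f t < 0} := by
    have := MeasureTheory.integral_sub (hI hP (x 0) (x m)) (hI hN (x 0) (x m))
    rw [hset hP, hset hN] at this
    exact this
  rw [← h1, MeasureTheory.integral_Icc_eq_integral_Ioc,
    ← intervalIntegral.integral_of_le (hx (Nat.zero_le m)),
    ← intervalIntegral.sum_integral_adjacent_intervals, Finset.mul_sum]
  · refine Finset.sum_congr rfl fun k hk => ?_
    have hk' := hsign k (Finset.mem_range.mp hk)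
    rw [intervalIntegral.integral_congr_Ioo_of_le (g := fun _ => s * (-1) ^ k) (hx (Nat.le_succ k))]
    · rw [intervalIntegral.integral_const, smul_eq_mul]
      ring
    · intro t ht
      have h := hk' t ht
      have hsk : s * (-1) ^ k = 1 ∨ s * (-1) ^ k = -1 := by
        rcases hs with rfl | rfl <;> rcases neg_one_pow_eq_or ℝ k with h | h <;> simp [h]
      rcases hsk with e | e <;> rw [e] at h <;> simp only [e, g, Pi.sub_apply]
      · have : 0 < f t := by linarith
        simp [Set.indicator, this, this.le]
      · have : f t < 0 := by linarith
        simp [Set.indicator, this, this.le]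
  · intro k _
    exact (intervalIntegrable_iff_integrableOn_Icc_of_le (hx (Nat.le_succ k))).mpr (hint _ _)

/-! ### Locating `I` among the zeros, and the final estimate. -/

lemma Monotone.exists_lt_and_le_succ {z : ℕ → ℝ} (hz : Monotone z) {c : ℝ} {N : ℕ}
    (h0 : z 0 < c) (hN : c ≤ z N) :
    ∃ p < N, (∀ k ≤ p, z k < c) ∧ ∀ k, p < k → c ≤ z k := by
  classical
  have hex : ∃ k, c ≤ z k := ⟨N, hN⟩
  obtain ⟨p, hp⟩ : ∃ p, Nat.find hex = p + 1 := by
    refine Nat.exists_eq_succ_of_ne_zero fun h => ?_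
    have := Nat.find_spec hex
    rw [h] at this
    exact this.not_gt h0
  refine ⟨p, ?_, fun k hk => ?_, fun k hk => ?_⟩
  · have := Nat.find_min' hex hN
    omega
  · exact not_le.mp (Nat.find_min hex (by omega))
  · have := Nat.find_spec hex
    rw [hp] at this
    exact this.trans (hz hk)

lemma Monotone.exists_le_and_lt_succ {z : ℕ → ℝ} (hz : Monotone z) {c : ℝ} {N : ℕ}
    (h0 : z 0 ≤ c) (hN : c < z N) :
    ∃ q < N, (∀ k ≤ q, z k ≤ c) ∧ ∀ k, q < k → c < z k := by
  classical
  have hex : ∃ k, c < z k := ⟨N, hN⟩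
  obtain ⟨q, hq⟩ : ∃ q, Nat.find hex = q + 1 := by
    refine Nat.exists_eq_succ_of_ne_zero fun h => ?_
    have := Nat.find_spec hex
    rw [h] at this
    exact this.not_ge h0
  refine ⟨q, ?_, fun k hk => ?_, fun k hk => ?_⟩
  · have := Nat.find_min' hex hN
    omega
  · exact not_lt.mp (Nat.find_min hex (by omega))
  · have := Nat.find_spec hex
    rw [hq] at this
    exact this.trans_le (hz hk)

lemma Fin.sum_filter_eq_sum_range {M : Type*} [AddCommMonoid M] {n p m : ℕ} (hpm : p + m ≤ n)
    {P : Fin n → Prop} [DecidablePred P] (hP : ∀ j : Fin n, P j ↔ p ≤ (j : ℕ) ∧ (j : ℕ) < p + m)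
    (F : ℕ → M) :
    ∑ j ∈ Finset.univ.filter P, F j = ∑ k ∈ Finset.range m, F (p + k) := by
  simp only [Finset.sum_filter, hP]
  rw [Fin.sum_univ_eq_sum_range (fun j => if p ≤ j ∧ j < p + m then F j else 0),
    ← Finset.sum_filter]
  have : (Finset.range n).filter (fun j => p ≤ j ∧ j < p + m) = Finset.Ico p (p + m) := by
    ext j
    simp only [Finset.mem_filter, Finset.mem_range, Finset.mem_Ico]
    omega
  rw [this, Finset.sum_Ico_eq_sum_range, Nat.add_sub_cancel_left]

lemma IsLegendreAngles.alternating_bounds {n : ℕ} {θ : Fin n → ℝ} (hθ : IsLegendreAngles n θ)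
    {a b : ℝ} (ha : 0 < a) (hab : a ≤ b) (hb : b < Real.pi)
    (heven : Even (Finset.univ.filter fun j : Fin n => θ j ∈ Set.Icc a b).card) :
    |(|∑ j ∈ Finset.univ.filter (fun j : Fin n => θ j ∈ Set.Icc a b),
        (-1 : ℝ) ^ ((j : ℕ) + 1) * θ j|) - (b - a) / 2| ≤ 7 / 4 * (Real.pi / (n + 1 / 2)) ∧
    |MeasureTheory.volume.real
        {t : ℝ | t ∈ Set.Icc a b ∧ 0 < (legendreP n).eval (Real.cos t)} -
      MeasureTheory.volume.real
        {t : ℝ | t ∈ Set.Icc a b ∧ (legendreP n).eval (Real.cos t) < 0}| ≤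
      7 / 2 * (Real.pi / (n + 1 / 2)) := by
  have hz := hθ.framedAngles_monotone
  have hgap := hθ.framedAngles_succ_sub_le
  have hadd := hθ.framedAngles_add_sub_le
  have hpi : Real.pi = (n + 1 / 2) * (Real.pi / (n + 1 / 2)) := by field_simp
  have hh0 : 0 ≤ Real.pi / ((n : ℝ) + 1 / 2) := by have := Real.pi_pos; positivity
  have hzπ : framedAngles θ (n + 1) = Real.pi := framedAngles_of_lt (Nat.lt_succ_self n)
  have hz0 : framedAngles θ 0 = 0 := framedAngles_zero
  -- Since entry `0` of the framed list is not a zero, `p` counts the zeros below `a` and `q` those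
  -- at most `b`; in between lie the `m = q - p` zeros in `I`.
  obtain ⟨p, hp, hpl, hpr⟩ := hz.exists_lt_and_le_succ (c := a) (N := n + 1) (by rwa [hz0])
    (by rw [hzπ]; linarith)
  obtain ⟨q, hq, hql, hqr⟩ := hz.exists_le_and_lt_succ (c := b) (N := n + 1)
    (by rw [hz0]; linarith) (by rwa [hzπ])
  obtain ⟨m, rfl⟩ : ∃ m, q = p + m := by
    refine Nat.exists_eq_add_of_le (not_lt.mp fun hlt => ?_)
    linarith [hqr p hlt, hpl p le_rfl]
  have hP : ∀ j : Fin n, θ j ∈ Set.Icc a b ↔ p ≤ (j : ℕ) ∧ (j : ℕ) < p + m := by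
    intro j
    rw [← framedAngles_succ (θ := θ) j, Set.mem_Icc]
    constructor
    · rintro ⟨h1, h2⟩
      constructor <;> by_contra! hlt
      · exact h1.not_gt (hpl _ hlt)
      · exact h2.not_gt (hqr _ (by omega))
    · rintro ⟨h1, h2⟩
      exact ⟨hpr _ (by omega), hql _ h2⟩
  have hm : Even m := by
    have := Fin.sum_filter_eq_sum_range (by omega) hP (fun _ => 1)
    simp only [Finset.sum_const, smul_eq_mul, mul_one, Finset.card_range] at this
    rwa [this] at heven
  generalize hh : Real.pi / ((n : ℝ) + 1 / 2) = h at *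
  -- Clamping the framed list to `[a, b]` divides `I` into `m + 1` pieces, and clamping does not
  -- lengthen gaps.
  obtain ⟨x, hx⟩ : ∃ x : ℕ → ℝ, ∀ k, x k = max a (min b (framedAngles θ (p + k))) :=
    ⟨_, fun _ => rfl⟩
  have hxmono : Monotone x := fun i j hij => by
    rw [hx, hx]
    exact max_le_max le_rfl (min_le_min le_rfl (hz (by omega)))
  have hx0 : x 0 = a := by
    rw [hx]
    exact max_eq_left ((min_le_right _ _).trans (hpl p le_rfl).le)
  have hxm : x (m + 1) = b := by
    rw [hx, min_eq_left (hqr _ (by omega)).le, max_eq_right hab]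
  have hxin : ∀ k < m, x (k + 1) = framedAngles θ (p + k + 1) := fun k hk => by
    rw [hx, ← add_assoc, min_eq_right (hql _ (by omega)), max_eq_right (hpr _ (by omega))]
  have hxgap : ∀ k, x (k + 1) - x k ≤ h := fun k => by
    have h1 := hgap (p + k)
    have h2 := hz (Nat.le_succ (p + k))
    rw [hx, hx, ← add_assoc]
    rcases max_cases a (min b (framedAngles θ (p + k + 1))) with h3 | h3 <;>
    rcases max_cases a (min b (framedAngles θ (p + k))) with h4 | h4 <;>
    rcases min_cases b (framedAngles θ (p + k + 1)) with h5 | h5 <;>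
    rcases min_cases b (framedAngles θ (p + k)) with h6 | h6 <;> linarith
  -- At most `p + 1` gaps precede the first division point and `r + 1` follow the last, where `n = p
  -- + m + r`. So `b - a ≥ (n + 1/2) h - (p + r + 2) h = (m - 3/2) h`. The total deficit is then at
  -- most `5/2 * h`, and the unpaired `h` brings it to `7/2 * h`.
  have hD : |∑ k ∈ Finset.range (m + 1), (-1) ^ k * (x (k + 1) - x k)| ≤ 7 / 2 * h := by
    refine (abs_sum_neg_one_pow_mul_le hm hh0 hxgap).trans ?_
    rw [Finset.sum_range_sub, hx0, hxm]
    have h1 := hpr (p + 1) (by omega)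
    have h2 := hql (p + m) le_rfl
    have h3 := hadd 0 (p + 1)
    obtain ⟨r, hr⟩ := Nat.exists_eq_add_of_lt hq
    have h4 := hadd (p + m) (r + 1)
    rw [← add_assoc, ← hr, hzπ] at h4
    have hr' : (n : ℝ) = p + m + r := by exact_mod_cast Nat.succ_injective hr
    rw [zero_add, hz0] at h3
    rw [hr'] at hpi
    push_cast at h3 h4
    linarith
  have hS : ∑ j ∈ Finset.univ.filter (fun j : Fin n => θ j ∈ Set.Icc a b),
      (-1 : ℝ) ^ ((j : ℕ) + 1) * θ j =
      (-1) ^ (p + 1) * ∑ k ∈ Finset.range m, (-1) ^ k * x (k + 1) := by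
    have := Fin.sum_filter_eq_sum_range (by omega) hP
      (fun j => (-1 : ℝ) ^ (j + 1) * framedAngles θ (j + 1))
    simp only [framedAngles_succ] at this
    rw [this, Finset.mul_sum]
    refine Finset.sum_congr rfl fun k hk => ?_
    rw [hxin k (Finset.mem_range.mp hk)]
    ring
  constructor
  -- The inner alternating sum pairs off into nonpositive terms, so the signed length equals `(b -
  -- a) - 2 |∑|`; halving turns `7/2` into `7/4`.
  · rw [sum_neg_one_pow_mul_sub, hm.neg_one_pow, hx0, hxm, one_mul] at hD
    rw [hS, abs_mul, abs_neg_one_pow, one_mul, abs_of_nonpos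
      (sum_neg_one_pow_mul_nonpos_of_even (x := fun k => x (k + 1))
        (fun i j hij => hxmono (by omega)) hm)]
    rw [abs_le] at hD ⊢
    constructor <;> linarith [hD.1, hD.2]
  · have hf : Measurable fun t => (legendreP n).eval (Real.cos t) :=
      ((legendreP n).continuous.comp Real.continuous_cos).measurable
    have := volume_real_pos_sub_volume_real_neg hf hxmono (neg_one_pow_eq_or ℝ p) (m := m + 1)
      fun k hk t ht => by
        rw [← pow_add]
        refine hθ.sign_eval (by omega) ?_
        obtain ⟨h1, h2⟩ := ht
        rw [hx, max_lt_iff, min_lt_iff] at h1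
        rw [hx, lt_max_iff, lt_min_iff] at h2
        have h3 : t < b ∧ t < framedAngles θ (p + (k + 1)) :=
          h2.resolve_left h1.1.not_gt
        exact ⟨h1.2.resolve_left h3.1.not_gt, h3.2⟩
    rw [hx0, hxm] at this
    rwa [this, abs_mul, abs_neg_one_pow, one_mul]

theorem theorem1 :
    (∀ n : ℕ, ∃! θ : Fin n → ℝ, IsLegendreAngles n θ) ∧
    ∀ a b : ℝ, 0 < a → a ≤ b → b < Real.pi →
      ∃ C : ℝ, ∀ n : ℕ, 1 ≤ n → ∀ θ : Fin n → ℝ, IsLegendreAngles n θ →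
        Even (Finset.univ.filter fun j : Fin n => θ j ∈ Set.Icc a b).card →
          |(|∑ j ∈ Finset.univ.filter (fun j : Fin n => θ j ∈ Set.Icc a b),
              (-1 : ℝ) ^ ((j : ℕ) + 1) * θ j|) - (b - a) / 2| ≤ C / (n : ℝ) ∧
          |MeasureTheory.volume.real
              {t : ℝ | t ∈ Set.Icc a b ∧ 0 < (legendreP n).eval (Real.cos t)} -
            MeasureTheory.volume.real
              {t : ℝ | t ∈ Set.Icc a b ∧ (legendreP n).eval (Real.cos t) < 0}| ≤ C / (n : ℝ) := by
  refine ⟨existsUnique_isLegendreAngles, fun a b ha hab hb =>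
    ⟨7 / 2 * Real.pi, fun n hn θ hθ heven => ?_⟩⟩
  have hn' : (0 : ℝ) < n := by exact_mod_cast hn
  have hpi := Real.pi_pos
  obtain ⟨h1, h2⟩ := hθ.alternating_bounds ha hab hb heven
  have hle : 7 / 2 * (Real.pi / (n + 1 / 2)) ≤ 7 / 2 * Real.pi / n := by
    rw [mul_div_assoc]
    gcongr
    linarith
  have h0 : 0 ≤ Real.pi / ((n : ℝ) + 1 / 2) := by positivity
  exact ⟨h1.trans (by linarith), h2.trans hle⟩
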